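/- All rings are commutative with identity. Let $A$ be an almost Dedekind domain, i.e. an integral domain such that the localization $A_M$ is a (rank one) discrete valuation domain for every maximal ideal $M$ of $A$, and suppose that only finitely many maximal ideals of $A$ are noninvertible (as fractional ideals of $A$). Then $A$ is an ISP-domain if and only if $A$ is an SP-domain. Here $A$ is called an SP-domain if every ideal of $A$ is a finite product of radical ideals, and an ISP-domain if every proper nonzero ideal $I$ of $A$ can be written as $I = JQ_1\cdots Q_n$, where $n\ge 1$, $J$ is an invertible ideal of $A$ and each $Q_i$ is a proper radical ideal of $A$. -/

import Mathlib

open scoped nonZeroDivisors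

/-- An (integral) ideal `I` of a domain `A` is invertible if it has an inverse among the fractional
ideals of `A`, i.e. `I * I' = A` for some fractional ideal `I'`. -/
def IsInvertibleIdeal {A : Type*} [CommRing A] [IsDomain A] (I : Ideal A) : Prop :=
  IsUnit (I : FractionalIdeal A⁰ (FractionRing A))

/-- A domain is almost Dedekind if its localization at every maximal ideal is a (rank one)
discrete valuation domain. -/
def IsAlmostDedekind (A : Type*) [CommRing A] [IsDomain A] : Prop :=
  ∀ M : Ideal A, ∀ _ : M.IsMaximal, IsDiscreteValuationRing (Localization.AtPrime M)

/-- A domain is an SP-domain if each of its ideals is a (finite) product of radical ideals. -/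
def IsSPDomain (A : Type*) [CommRing A] [IsDomain A] : Prop :=
  ∀ I : Ideal A, ∃ Q : Multiset (Ideal A), (∀ H ∈ Q, H.IsRadical) ∧ I = Q.prod

/-- A domain is an ISP-domain if every proper nonzero ideal is the product of an invertible ideal
and a nonempty (finite) product of proper radical ideals. -/
def IsISPDomain (A : Type*) [CommRing A] [IsDomain A] : Prop :=
  ∀ I : Ideal A, I ≠ ⊥ → I ≠ ⊤ →
    ∃ (J : Ideal A) (Q : Multiset (Ideal A)), IsInvertibleIdeal J ∧ Q ≠ 0 ∧
      (∀ H ∈ Q, H.IsRadical ∧ H ≠ ⊤) ∧ I = J * Q.prod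

/-! In an almost Dedekind domain a nonzero ideal is determined by its orders at the maximal ideals,
and a nonzero ideal is radical exactly when all its orders are at most 1. The bridge between the two
properties is: every maximal ideal contains a nonzero finitely generated radical ideal. Given this,
the orders of `I` are bounded (`exists_ordAt_bound`), and the intersection of the maximal ideals
where the order exceeds `k` picks up no further maximal ideals (`ordAt_sInf`); multiplying these
intersections over `k` recovers `I`. ISP gives the bridge. For `M` noninvertible, prime avoidance
yields `x` in `M` but not in `M ^ 2`, outside all other noninvertible maximal ideals. By
`finite_mem_sq_of_isISPDomain`, `x` has order at least 2 at only finitely many maximal ideals, all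
invertible; dividing them out of `(x)` leaves an invertible radical ideal inside `M`. -/

section

/-! ### Orders of ideals at maximal ideals -/

variable {A : Type*} [CommRing A]

/-- The largest `k` with `I ≤ N ^ k`: in an almost Dedekind domain, the valuation of the nonzero
ideal `I` at the maximal ideal `N`. -/
noncomputable def ordAt (N I : Ideal A) : ℕ := sInf {k | ¬ I ≤ N ^ (k + 1)}

theorem map_atPrime_le_maximalIdeal_pow (N I : Ideal A) [N.IsMaximal] (k : ℕ) :
    I.map (algebraMap A (Localization.AtPrime N)) ≤
      IsLocalRing.maximalIdeal (Localization.AtPrime N) ^ k ↔ I ≤ N ^ k := by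
  rw [Ideal.map_le_iff_le_comap]
  have := IsLocalization.AtPrime.under_maximalIdeal_pow N (Localization.AtPrime N) k
  rw [Ideal.under_def] at this
  rw [this]

theorem maximalIdeal_pow_le_pow {R : Type*} [CommRing R] [IsDomain R]
    [IsDiscreteValuationRing R] (a b : ℕ) :
    IsLocalRing.maximalIdeal R ^ a ≤ IsLocalRing.maximalIdeal R ^ b ↔ b ≤ a :=
  (Ideal.pow_right_strictAnti _ (IsDiscreteValuationRing.not_a_field R)
    (IsLocalRing.maximalIdeal.isMaximal R).ne_top).le_iff_ge

variable [IsDomain A]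

theorem map_atPrime_ne_bot {I : Ideal A} (N : Ideal A) [N.IsPrime] (hI : I ≠ ⊥) :
    I.map (algebraMap A (Localization.AtPrime N)) ≠ ⊥ := by
  rwa [Ne, Ideal.map_eq_bot_iff_of_injective
    (IsLocalization.injective _ N.primeCompl_le_nonZeroDivisors)]

namespace IsAlmostDedekind

variable (hA : IsAlmostDedekind A)
include hA

theorem map_eq_pow_ordAt {N I : Ideal A} [hN : N.IsMaximal] (hI : I ≠ ⊥) :
    I.map (algebraMap A (Localization.AtPrime N)) =
      IsLocalRing.maximalIdeal (Localization.AtPrime N) ^ ordAt N I := by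
  have := hA N hN
  obtain ⟨ϖ, hϖ⟩ := IsDiscreteValuationRing.exists_irreducible (Localization.AtPrime N)
  obtain ⟨e, he⟩ := IsDiscreteValuationRing.ideal_eq_span_pow_irreducible
    (map_atPrime_ne_bot N hI) hϖ
  rw [← Ideal.span_singleton_pow, ← hϖ.maximalIdeal_eq] at he
  have key : ordAt N I = e := by
    have : {k | ¬ I ≤ N ^ (k + 1)} = Set.Ici e := by
      ext k
      rw [Set.mem_ofPred_eq, ← map_atPrime_le_maximalIdeal_pow, he, maximalIdeal_pow_le_pow]
      simp
    rw [ordAt, this, csInf_Ici]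
  rw [key, he]

theorem le_ordAt_iff {N I : Ideal A} [hN : N.IsMaximal] (hI : I ≠ ⊥) (k : ℕ) :
    k ≤ ordAt N I ↔ I ≤ N ^ k := by
  have := hA N hN
  rw [← map_atPrime_le_maximalIdeal_pow, hA.map_eq_pow_ordAt hI, maximalIdeal_pow_le_pow]

theorem ordAt_mul {N I J : Ideal A} [hN : N.IsMaximal] (hI : I ≠ ⊥) (hJ : J ≠ ⊥) :
    ordAt N (I * J) = ordAt N I + ordAt N J := by
  have := hA N hN
  have hIJ : I * J ≠ ⊥ := mul_ne_zero hI hJ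
  have h : IsLocalRing.maximalIdeal (Localization.AtPrime N) ^ ordAt N (I * J) =
      IsLocalRing.maximalIdeal (Localization.AtPrime N) ^ (ordAt N I + ordAt N J) := by
    rw [← hA.map_eq_pow_ordAt hIJ, Ideal.map_mul, hA.map_eq_pow_ordAt hI,
      hA.map_eq_pow_ordAt hJ, pow_add]
  exact le_antisymm ((maximalIdeal_pow_le_pow _ _).1 h.ge) ((maximalIdeal_pow_le_pow _ _).1 h.le)

theorem ordAt_pow {N I : Ideal A} [hN : N.IsMaximal] (hI : I ≠ ⊥) (n : ℕ) :
    ordAt N (I ^ n) = n * ordAt N I := by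
  induction n with
  | zero =>
    have : ¬ 1 ≤ ordAt N (1 : Ideal A) := by
      rw [hA.le_ordAt_iff one_ne_zero, pow_one, Ideal.one_eq_top, top_le_iff]
      exact hN.ne_top
    rw [pow_zero]
    omega
  | succ n ih => rw [pow_succ, hA.ordAt_mul (pow_ne_zero n hI) hI, ih, Nat.succ_mul]

theorem le_of_ordAt_le {I J : Ideal A} (hI : I ≠ ⊥) (hJ : J ≠ ⊥)
    (h : ∀ N : Ideal A, N.IsMaximal → ordAt N J ≤ ordAt N I) : I ≤ J := by
  refine Ideal.le_of_localization_maximal fun N hN => ?_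
  rw [hA.map_eq_pow_ordAt hI, hA.map_eq_pow_ordAt hJ]
  exact Ideal.pow_le_pow_right (h N hN)

theorem ordAt_eq_zero_iff {N I : Ideal A} [hN : N.IsMaximal] (hI : I ≠ ⊥) :
    ordAt N I = 0 ↔ ¬ I ≤ N := by
  rw [← not_iff_not, not_not, ← Ne, ← Nat.one_le_iff_ne_zero, hA.le_ordAt_iff hI, pow_one]

theorem maximal_ne_bot {N : Ideal A} (hN : N.IsMaximal) : N ≠ ⊥ := by
  rintro rfl
  have := hA ⊥ hN
  apply IsDiscreteValuationRing.not_a_field (Localization.AtPrime (⊥ : Ideal A))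
  rw [← IsLocalization.AtPrime.map_eq_maximalIdeal (⊥ : Ideal A), Ideal.map_bot]

theorem ordAt_self {N : Ideal A} [hN : N.IsMaximal] : ordAt N N = 1 := by
  have := hA N hN
  have h := hA.map_eq_pow_ordAt (N := N) (hA.maximal_ne_bot hN)
  rw [IsLocalization.AtPrime.map_eq_maximalIdeal N] at h
  nth_rw 1 [← pow_one (IsLocalRing.maximalIdeal _)] at h
  exact le_antisymm ((maximalIdeal_pow_le_pow _ _).1 h.le) ((maximalIdeal_pow_le_pow _ _).1 h.ge)

theorem ordAt_of_ne {N N' : Ideal A} [hN : N.IsMaximal] (hN' : N'.IsMaximal) (h : N' ≠ N) :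
    ordAt N N' = 0 :=
  (hA.ordAt_eq_zero_iff (hA.maximal_ne_bot hN')).2 fun hle => h (hN'.eq_of_le hN.ne_top hle)

theorem ordAt_le_one_of_isRadical {N I : Ideal A} [hN : N.IsMaximal] (hI : I ≠ ⊥)
    (hr : I.IsRadical) : ordAt N I ≤ 1 := by
  have := hA N hN
  by_contra! hlt
  have h := hA.map_eq_pow_ordAt (N := N) hI
  have h1 := IsLocalization.map_radical N.primeCompl (Localization.AtPrime N) I
  rw [hr.radical, h, Ideal.radical_pow _ (by omega),
    (IsLocalRing.maximalIdeal.isMaximal _).isPrime.radical] at h1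
  nth_rw 2 [← pow_one (IsLocalRing.maximalIdeal _)] at h1
  have := (maximalIdeal_pow_le_pow _ _).1 h1.ge
  omega

theorem isRadical_of_ordAt_le_one {I : Ideal A} (hI : I ≠ ⊥)
    (h : ∀ N : Ideal A, N.IsMaximal → ordAt N I ≤ 1) : I.IsRadical := by
  have hI' : I.radical ≠ ⊥ := fun h => hI (le_bot_iff.1 (Ideal.le_radical.trans h.le))
  refine hA.le_of_ordAt_le hI' hI fun N hN => ?_
  obtain h0 | h0 := Nat.eq_zero_or_pos (ordAt N I)
  · omega
  · refine (h N hN).trans ((hA.le_ordAt_iff hI' 1).2 ?_)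
    rw [pow_one, hN.isPrime.radical_le_iff]
    simpa using (hA.le_ordAt_iff hI 1).1 h0

/-- Each generator of `K` has its own denominator outside `N`; finite generation lets them be
multiplied together. -/
theorem exists_notMem_mul_le {N K J : Ideal A} [hN : N.IsMaximal] (hK : K.FG) (hK0 : K ≠ ⊥)
    (hJ : J ≠ ⊥) (h : ordAt N J ≤ ordAt N K) : ∃ p ∉ N, Ideal.span {p} * K ≤ J := by
  have hle : K.map (algebraMap A (Localization.AtPrime N)) ≤
      J.map (algebraMap A (Localization.AtPrime N)) := by
    rw [hA.map_eq_pow_ordAt hK0, hA.map_eq_pow_ordAt hJ]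
    exact Ideal.pow_le_pow_right h
  obtain ⟨s, rfl⟩ := hK
  have hex : ∀ g : s, ∃ p : A, p ∉ N ∧ p * g ∈ J := fun g => by
    have := hle (Ideal.mem_map_of_mem _ (Submodule.subset_span g.2))
    obtain ⟨p, hp, hpg⟩ := (IsLocalization.algebraMap_mem_map_algebraMap_iff N.primeCompl
      (Localization.AtPrime N) _ _).1 this
    exact ⟨p, hp, hpg⟩
  choose p hp hpg using hex
  refine ⟨∏ g, p g, fun hmem => ?_, ?_⟩
  · obtain ⟨g, -, hg⟩ := hN.isPrime.prod_mem_iff.1 hmem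
    exact hp g hg
  · rw [Ideal.span_mul_span, Ideal.span_le]
    simp only [Set.singleton_mul, Set.image_subset_iff]
    intro g hg
    obtain ⟨c, hc⟩ := Finset.dvd_prod_of_mem p (Finset.mem_univ (⟨g, hg⟩ : s))
    simp only [Set.mem_preimage, SetLike.mem_coe]
    rw [hc, mul_right_comm]
    exact J.mul_mem_right _ (hpg ⟨g, hg⟩)

theorem isMaximal_of_isPrime {P : Ideal A} (hP : P.IsPrime) (h0 : P ≠ ⊥) : P.IsMaximal := by
  obtain ⟨N, hN, hPN⟩ := P.exists_le_maximal hP.ne_top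
  suffices N ≤ P by rwa [le_antisymm hPN this]
  have hd : Disjoint (N.primeCompl : Set A) P :=
    Set.disjoint_left.2 fun x hx hxP => hx (hPN hxP)
  have hpr := IsLocalization.isPrime_of_isPrime_disjoint N.primeCompl (Localization.AtPrime N)
    P hP hd
  have hc := IsLocalization.under_map_of_isPrime_disjoint N.primeCompl (Localization.AtPrime N)
    hP hd
  have he := hA.map_eq_pow_ordAt (N := N) h0
  rw [he] at hpr
  have hle := hpr.le_of_pow_le le_rfl
  rw [← he, ← IsLocalization.AtPrime.map_eq_maximalIdeal N] at hle
  rw [← hc]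
  exact Ideal.map_le_iff_le_comap.1 hle

/-- Nonzero primes are maximal, so Cohen's theorem makes `A ⧸ P` Noetherian, and the maximal ideals
over `P` are minimal primes of `P`. -/
theorem finite_maximals_of_fg {P : Ideal A} (hP : P ≠ ⊥)
    (h : ∀ N : Ideal A, N.IsMaximal → P ≤ N → N.FG) :
    {N : Ideal A | N.IsMaximal ∧ P ≤ N}.Finite := by
  have hmk : ∀ I : Ideal (A ⧸ P), P ≤ I.comap (Ideal.Quotient.mk P) := fun I x hx => by
    rw [Ideal.mem_comap, Ideal.Quotient.eq_zero_iff_mem.2 hx]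
    exact I.zero_mem
  have hmax : ∀ I : Ideal (A ⧸ P), I.IsPrime → (I.comap (Ideal.Quotient.mk P)).IsMaximal :=
    fun I hI => hA.isMaximal_of_isPrime inferInstance
      fun h0 => hP (le_bot_iff.1 ((hmk I).trans h0.le))
  have hnoeth : IsNoetherianRing (A ⧸ P) := .of_prime fun I hI => by
    rw [← Ideal.map_comap_of_surjective _ Ideal.Quotient.mk_surjective I]
    exact (h _ (hmax I hI) (hmk I)).map _
  have hfin : P.minimalPrimes.Finite := by
    rw [Ideal.minimalPrimes_eq_comap]
    exact (minimalPrimes.finite_of_isNoetherianRing _).image _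
  refine hfin.subset fun N ⟨hN, hPN⟩ => ⟨⟨hN.isPrime, hPN⟩, fun Q ⟨hQ, hPQ⟩ hQN => ?_⟩
  have hQ0 : Q ≠ ⊥ := fun h0 => hP (le_bot_iff.1 (hPQ.trans h0.le))
  exact ((hA.isMaximal_of_isPrime hQ hQ0).eq_of_le hN.ne_top hQN).ge
end IsAlmostDedekind

end

/-! ### From finitely generated radical ideals to SP -/

namespace IsAlmostDedekind

variable {A : Type*} [CommRing A] [IsDomain A] (hA : IsAlmostDedekind A)
include hA

/-- With `c` the order of `y` at `M`, the ideal `R ^ c` has order at least `c` at `M` and at most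
`c` everywhere. Some `p` outside `M` multiplies it into `(y)`. -/
theorem exists_ordAt_le_add {R : Ideal A} {y : A} (M : Ideal A) [hM : M.IsMaximal] (hRM : R ≤ M)
    (hR0 : R ≠ ⊥) (hfg : R.FG) (hr : R.IsRadical) (hy : y ≠ 0) :
    ∃ p ∉ M, ∀ N : Ideal A, N.IsMaximal →
      ordAt N (Ideal.span {y}) ≤ ordAt N (Ideal.span {p}) + ordAt M (Ideal.span {y}) := by
  have hy0 : Ideal.span {y} ≠ ⊥ := by simpa using hy
  set c := ordAt M (Ideal.span {y}) with hc
  have hRc : R ^ c ≠ ⊥ := pow_ne_zero c hR0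
  have hle : ordAt M (Ideal.span {y}) ≤ ordAt M (R ^ c) := by
    rw [hA.ordAt_pow hR0, ← hc]
    exact Nat.le_mul_of_pos_right c ((hA.le_ordAt_iff hR0 1).2 (by rwa [pow_one]))
  obtain ⟨p, hpM, hp⟩ := hA.exists_notMem_mul_le hfg.pow hRc hy0 hle
  refine ⟨p, hpM, fun N hN => ?_⟩
  have hp0 : Ideal.span {p} ≠ ⊥ := by
    rintro h0
    exact hpM (by simp_all)
  have h1 : ordAt N (Ideal.span {y}) ≤ ordAt N (Ideal.span {p} * R ^ c) :=
    (hA.le_ordAt_iff (mul_ne_zero hp0 hRc) _).2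
      (hp.trans ((hA.le_ordAt_iff hy0 _).1 le_rfl))
  rw [hA.ordAt_mul hp0 hRc, hA.ordAt_pow hR0] at h1
  have := Nat.mul_le_mul_left c (hA.ordAt_le_one_of_isRadical (N := N) hR0 hr)
  omega

theorem ordAt_span_singleton_eq_zero {N : Ideal A} [hN : N.IsMaximal] {p : A} (hp : p ∉ N) :
    ordAt N (Ideal.span {p}) = 0 := by
  refine (hA.ordAt_eq_zero_iff ?_).2 (by simpa using hp)
  rintro h0
  exact hp (by simp_all)

theorem ordAt_anti {N I J : Ideal A} [hN : N.IsMaximal] (hI : I ≠ ⊥) (hle : I ≤ J) :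
    ordAt N J ≤ ordAt N I := by
  have hJ : J ≠ ⊥ := fun h0 => hI (le_bot_iff.1 (hle.trans h0.le))
  exact (hA.le_ordAt_iff hI _).2 (hle.trans ((hA.le_ordAt_iff hJ _).1 le_rfl))

variable (hR : ∀ M : Ideal A, M.IsMaximal → ∃ R ≤ M, R ≠ ⊥ ∧ R.FG ∧ R.IsRadical)
include hR

theorem exists_ordAt_bound {I : Ideal A} (hI : I ≠ ⊥) :
    ∃ B, ∀ N : Ideal A, N.IsMaximal → ordAt N I ≤ B := by
  obtain ⟨y, hyI, hy⟩ := Submodule.exists_mem_ne_zero_of_ne_bot hI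
  have hy0 : Ideal.span {y} ≠ ⊥ := by simpa using hy
  -- Compactness of the spectrum: the `p` on whose nonvanishing locus the orders of `y` are bounded
  -- form an ideal, which lies in no maximal ideal.
  let K : Ideal A :=
    { carrier := {p | ∃ B, ∀ N : Ideal A, N.IsMaximal → p ∉ N → ordAt N (Ideal.span {y}) ≤ B}
      zero_mem' := ⟨0, fun N _ h => absurd N.zero_mem h⟩
      add_mem' := by
        rintro p q ⟨B, hB⟩ ⟨C, hC⟩
        refine ⟨max B C, fun N hN hpq => ?_⟩
        by_cases hp : p ∈ N
        · exact (hC N hN fun hq => hpq (N.add_mem hp hq)).trans (le_max_right _ _)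
        · exact (hB N hN hp).trans (le_max_left _ _)
      smul_mem' := by
        rintro a p ⟨B, hB⟩
        exact ⟨B, fun N hN h => hB N hN fun hp => h (N.mul_mem_left a hp)⟩ }
  have hK : K = ⊤ := by
    by_contra hK
    obtain ⟨M, hM, hKM⟩ := K.exists_le_maximal hK
    obtain ⟨R, hRM, hR0, hfg, hr⟩ := hR M hM
    obtain ⟨p, hpM, hp⟩ := hA.exists_ordAt_le_add M hRM hR0 hfg hr hy
    refine hpM (hKM ⟨ordAt M (Ideal.span {y}), fun N hN hpN => ?_⟩)
    simpa [hA.ordAt_span_singleton_eq_zero hpN] using hp N hN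
  obtain ⟨B, hB⟩ := (K.eq_top_iff_one.1 hK : (1 : A) ∈ K)
  refine ⟨B, fun N hN => ?_⟩
  exact (hA.ordAt_anti hy0 (by simpa using hyI)).trans
    (hB N hN (N.ne_top_iff_one.1 hN.ne_top))

theorem ordAt_sInf {I : Ideal A} (hI : I ≠ ⊥) (k : ℕ) (M : Ideal A) [hM : M.IsMaximal] :
    ordAt M (sInf {N : Ideal A | N.IsMaximal ∧ I ≤ N ^ (k + 1)}) =
      if k < ordAt M I then 1 else 0 := by
  set Q := sInf {N : Ideal A | N.IsMaximal ∧ I ≤ N ^ (k + 1)} with hQdef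
  have hIQ : I ≤ Q := le_sInf fun N hN => hN.2.trans (Ideal.pow_le_self k.succ_ne_zero)
  have hQ : Q ≠ ⊥ := fun h0 => hI (le_bot_iff.1 (hIQ.trans h0.le))
  have hrad : Q.IsRadical := by
    rw [hQdef, sInf_eq_iInf']
    exact Ideal.isRadical_iInf _ fun N => N.2.1.isPrime.isRadical
  split_ifs with hk
  · refine le_antisymm (hA.ordAt_le_one_of_isRadical hQ hrad) ((hA.le_ordAt_iff hQ 1).2 ?_)
    rw [pow_one]
    exact sInf_le ⟨hM, (hA.le_ordAt_iff hI _).1 hk⟩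
  -- For `y` in `I` of order at most `k` at `M`, the resulting `p` must lie in every maximal ideal
  -- where `I` has order above `k`, yet not in `M`.
  · have hIM : ¬ I ≤ M ^ (k + 1) := fun h => hk ((hA.le_ordAt_iff hI _).2 h)
    obtain ⟨y, hyI, hyM⟩ := SetLike.not_le_iff_exists.1 hIM
    have hy : y ≠ 0 := fun h0 => hyM (h0 ▸ zero_mem _)
    have hy0 : Ideal.span {y} ≠ ⊥ := by simpa using hy
    obtain ⟨R, hRM, hR0, hfg, hr⟩ := hR M hM
    obtain ⟨p, hpM, hp⟩ := hA.exists_ordAt_le_add M hRM hR0 hfg hr hy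
    have hc : ¬ k + 1 ≤ ordAt M (Ideal.span {y}) := by
      rw [hA.le_ordAt_iff hy0]
      simpa using hyM
    refine (hA.ordAt_eq_zero_iff hQ).2 fun hQM => hpM (hQM ?_)
    refine Ideal.mem_sInf.2 fun {N} hN => ?_
    have hNm := hN.1
    by_contra hpN
    have h1 : k + 1 ≤ ordAt N (Ideal.span {y}) :=
      (hA.le_ordAt_iff hy0 _).2 (by simpa using hN.2 hyI)
    have h2 := hp N hN.1
    rw [hA.ordAt_span_singleton_eq_zero hpN] at h2
    omega

theorem isSPDomain : IsSPDomain A := by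
  intro I
  obtain rfl | hI := eq_or_ne I ⊥
  · exact ⟨{⊥}, by simpa using Ideal.isPrime_bot.isRadical, by simp⟩
  obtain ⟨B, hB⟩ := hA.exists_ordAt_bound hR hI
  let Q : ℕ → Ideal A := fun k => sInf {N : Ideal A | N.IsMaximal ∧ I ≤ N ^ (k + 1)}
  have hQ0 : ∀ k, Q k ≠ ⊥ := fun k h0 => hI <| le_bot_iff.1 <| h0 ▸
    le_sInf fun N hN => hN.2.trans (Ideal.pow_le_self k.succ_ne_zero)
  have hprod : ∀ n, ∏ k ∈ Finset.range n, Q k ≠ ⊥ := fun n =>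
    Finset.prod_ne_zero_iff.2 fun k _ => hQ0 k
  have hord : ∀ N : Ideal A, N.IsMaximal → ∀ n,
      ordAt N (∏ k ∈ Finset.range n, Q k) = min n (ordAt N I) := by
    intro N hN n
    induction n with
    | zero => simpa using hA.ordAt_pow hI (N := N) 0
    | succ n ih =>
      rw [Finset.prod_range_succ, hA.ordAt_mul (hprod n) (hQ0 n), ih, hA.ordAt_sInf hR hI]
      split_ifs <;> omega
  refine ⟨(Finset.range B).val.map Q, ?_, le_antisymm (b := ∏ k ∈ Finset.range B, Q k) ?_ ?_⟩
  · intro H hH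
    obtain ⟨k, -, rfl⟩ := Multiset.mem_map.1 hH
    simp only [Q, sInf_eq_iInf']
    exact Ideal.isRadical_iInf _ fun N => N.2.1.isPrime.isRadical
  · exact hA.le_of_ordAt_le hI (hprod B) fun N hN => by
      rw [hord N hN]
      exact min_le_right _ _
  · refine hA.le_of_ordAt_le (hprod B) hI fun N hN => ?_
    rw [hord N hN, min_eq_right (hB N hN)]

end IsAlmostDedekind

/-! ### Invertible ideals, and SP implies ISP -/

namespace IsInvertibleIdeal

variable {A : Type*} [CommRing A] [IsDomain A] {I J K : Ideal A}

theorem fg (hI : IsInvertibleIdeal I) : I.FG :=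
  Ideal.fg_of_isUnit (IsFractionRing.injective A (FractionRing A)) I hI

theorem ne_bot (hI : IsInvertibleIdeal I) : I ≠ ⊥ := by
  rintro rfl
  simp [IsInvertibleIdeal] at hI

theorem mul_iff : IsInvertibleIdeal (I * J) ↔ IsInvertibleIdeal I ∧ IsInvertibleIdeal J := by
  rw [IsInvertibleIdeal, FractionalIdeal.coeIdeal_mul, IsUnit.mul_iff]
  rfl

theorem top : IsInvertibleIdeal (⊤ : Ideal A) := by
  simp [IsInvertibleIdeal]

theorem span_singleton {x : A} (hx : x ≠ 0) : IsInvertibleIdeal (Ideal.span {x}) := by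
  rw [IsInvertibleIdeal, FractionalIdeal.coeIdeal_span_singleton]
  refine IsUnit.of_mul_eq_one
    (FractionalIdeal.spanSingleton A⁰ (algebraMap A (FractionRing A) x)⁻¹) ?_
  rw [FractionalIdeal.spanSingleton_mul_spanSingleton, mul_inv_cancel₀ (by simpa using hx),
    FractionalIdeal.spanSingleton_one]

theorem pow (hI : IsInvertibleIdeal I) (n : ℕ) : IsInvertibleIdeal (I ^ n) := by
  rw [IsInvertibleIdeal, FractionalIdeal.coeIdeal_pow]
  exact IsUnit.pow n hI

theorem exists_eq_mul_of_le (hI : IsInvertibleIdeal I) (h : K ≤ I) : ∃ L, K = I * L := by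
  obtain ⟨u, hu⟩ := hI
  have hle : (K : FractionalIdeal A⁰ (FractionRing A)) ≤ I :=
    FractionalIdeal.coeIdeal_le_coeIdeal _ |>.2 h
  have h1 : (↑u⁻¹ * K : FractionalIdeal A⁰ (FractionRing A)) ≤ 1 := by
    calc (↑u⁻¹ * K : FractionalIdeal A⁰ (FractionRing A)) ≤ ↑u⁻¹ * I := by gcongr
      _ = 1 := by rw [← hu, Units.inv_mul]
  obtain ⟨L, hL⟩ := FractionalIdeal.le_one_iff_exists_coeIdeal.1 h1
  refine ⟨L, FractionalIdeal.coeIdeal_injective (K := FractionRing A) ?_⟩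
  simp only [FractionalIdeal.coeIdeal_mul]
  rw [hL, ← hu, Units.mul_inv_cancel_left]

end IsInvertibleIdeal

theorem IsSPDomain.isISPDomain {A : Type*} [CommRing A] [IsDomain A] (h : IsSPDomain A) :
    IsISPDomain A := by
  classical
  intro I hI0 hI
  obtain ⟨Q, hQ, rfl⟩ := h I
  have hprod : (Q.filter (· ≠ ⊤)).prod = Q.prod := by
    clear hI0 hI hQ
    induction Q using Multiset.induction_on with
    | empty => simp
    | cons H Q ih =>
      by_cases hH : H = ⊤
      · subst hH
        rw [Multiset.filter_cons_of_neg _ (by simp), ih, Multiset.prod_cons, Ideal.top_mul]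
      · rw [Multiset.filter_cons_of_pos (p := (· ≠ ⊤)) _ hH, Multiset.prod_cons, Multiset.prod_cons, ih]
  refine ⟨⊤, Q.filter (· ≠ ⊤), .top, fun h0 => ?_, fun H hH => ?_, ?_⟩
  · rw [h0, Multiset.prod_zero] at hprod
    exact hI (hprod.symm.trans Ideal.one_eq_top)
  · exact ⟨hQ H (Multiset.mem_filter.1 hH).1, (Multiset.mem_filter.1 hH).2⟩
  · rw [hprod, Ideal.top_mul]

theorem Ideal.le_pow_of_mul_le_pow {A : Type*} [CommRing A] {N P Q : Ideal A} [hN : N.IsMaximal]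
    {n : ℕ} (hP : ¬ P ≤ N) (h : P * Q ≤ N ^ n) : Q ≤ N ^ n := by
  obtain ⟨p, hp, hpN⟩ := SetLike.not_le_iff_exists.1 hP
  exact fun q hq => (IsMaximal.mul_mem_pow N (h (mul_mem_mul hp hq))).resolve_left hpN

/-! ### From ISP to finitely generated radical ideals -/

namespace IsAlmostDedekind

variable {A : Type*} [CommRing A] [IsDomain A] (hA : IsAlmostDedekind A)
include hA

theorem exists_invertible_ordAt_eq_zero {K : Ideal A} (hK : IsInvertibleIdeal K)
    {S : Set (Ideal A)} (hS : S.Finite) (hinv : ∀ N ∈ S, N.IsMaximal ∧ IsInvertibleIdeal N) :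
    ∃ L, IsInvertibleIdeal L ∧ K ≤ L ∧ (∀ N ∈ S, ordAt N L = 0) ∧
      ∀ N ∉ S, N.IsMaximal → ordAt N L = ordAt N K := by
  induction S, hS using Set.Finite.induction_on with
  | empty => exact ⟨K, hK, le_rfl, by simp, fun _ _ _ => rfl⟩
  | @insert N S hNS _ ih =>
    obtain ⟨L, hL, hKL, h0, h1⟩ := ih fun N' hN' => hinv N' (Or.inr hN')
    obtain ⟨hN, hNi⟩ := hinv N (Or.inl rfl)
    obtain ⟨L', hL'⟩ := (hNi.pow (ordAt N L)).exists_eq_mul_of_le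
      ((hA.le_ordAt_iff hL.ne_bot _).1 le_rfl)
    have hLi : IsInvertibleIdeal L' := (IsInvertibleIdeal.mul_iff.1 (hL' ▸ hL)).2
    have hord : ∀ N' : Ideal A, N'.IsMaximal →
        ordAt N' L = ordAt N L * ordAt N' N + ordAt N' L' := fun N' _ => by
      rw [← hA.ordAt_pow hNi.ne_bot, ← hA.ordAt_mul (hNi.pow _).ne_bot hLi.ne_bot, ← hL']
    have hne : ∀ N' : Ideal A, N'.IsMaximal → N' ≠ N → ordAt N' L' = ordAt N' L :=
      fun N' hN' h => by simp [hord N' hN', hA.ordAt_of_ne hN h.symm]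
    refine ⟨L', hLi, hKL.trans (hL'.le.trans Ideal.mul_le_right), ?_, ?_⟩
    · rintro N' (rfl | hN')
      · have := hord N' hN
        rw [hA.ordAt_self] at this
        omega
      · rw [hne N' (hinv N' (Or.inr hN')).1 (ne_of_mem_of_not_mem hN' hNS), h0 N' hN']
    · intro N' hN' hm
      rw [Set.mem_insert_iff, not_or] at hN'
      rw [hne N' hm hN'.1, h1 N' hN'.2 hm]

/-- Otherwise split the set into infinite halves `t` and `u`, and factor `I = M ⊓ ⨅ N ∈ u, N ^ 2`.
As `x ∉ M ^ 2`, only one factor lies in `M`; whether it is the invertible or a radical one, an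
infinite half lands in a finite set. -/
theorem finite_mem_sq_of_isISPDomain (hISP : IsISPDomain A) {M : Ideal A} [hM : M.IsMaximal]
    {x : A} (hxM : x ∈ M) (hx2 : x ∉ M ^ 2)
    (hx : ∀ N : Ideal A, N.IsMaximal → N ≠ M → x ∈ N → IsInvertibleIdeal N) :
    {N : Ideal A | N.IsMaximal ∧ x ∈ N ^ 2}.Finite := by
  have hx0 : x ≠ 0 := fun h0 => hx2 (h0 ▸ zero_mem _)
  have hxi := IsInvertibleIdeal.span_singleton hx0
  -- All maximal ideals over such a `P` are invertible, hence finitely generated.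
  have hsmall : ∀ P : Ideal A, x ∈ P → ¬ P ≤ M →
      {N : Ideal A | N.IsMaximal ∧ P ≤ N}.Finite := fun P hxP hPM => by
    refine hA.finite_maximals_of_fg ?_ fun N hN hPN =>
      (hx N hN (fun h => hPM (h ▸ hPN)) (hPN hxP)).fg
    rintro rfl
    exact hx0 hxP
  by_contra hinf
  obtain ⟨t, u, htu, hdisj, hcard⟩ :=
    Set.Infinite.exists_union_disjoint_cardinal_eq_of_infinite hinf
  have hiff : t.Infinite ↔ u.Infinite := by
    rw [← Set.infinite_coe_iff, ← Set.infinite_coe_iff, Cardinal.infinite_iff,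
      Cardinal.infinite_iff, hcard]
  have hor := Set.infinite_union.1 (htu.symm ▸ hinf)
  have ht : t.Infinite := hor.elim id hiff.2
  have hu : u.Infinite := hiff.1 ht
  have hS : ∀ N ∈ t ∪ u, N.IsMaximal ∧ x ∈ N ^ 2 := fun N hN => by rwa [htu] at hN
  have hSN : ∀ N ∈ t ∪ u, x ∈ N := fun N hN => Ideal.pow_le_self two_ne_zero (hS N hN).2
  have hSM : ∀ N ∈ t ∪ u, N ≠ M := fun N hN h => hx2 (h ▸ (hS N hN).2)
  have hSi : ∀ N ∈ t ∪ u, IsInvertibleIdeal N := fun N hN =>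
    hx N (hS N hN).1 (hSM N hN) (hSN N hN)
  let I : Ideal A := M ⊓ ⨅ N ∈ u, N ^ 2
  have hxI : x ∈ I := by
    refine ⟨hxM, ?_⟩
    simp only [SetLike.mem_coe, Submodule.mem_iInf]
    exact fun N hN => (hS N (Or.inr hN)).2
  have hIM : I ≤ M := inf_le_left
  have hIu : ∀ N ∈ u, I ≤ N ^ 2 := fun N hN => inf_le_right.trans (iInf₂_le N hN)
  have hIt : ∀ N ∈ t, ¬ I ≤ N := by
    intro N hN hIN
    have hNm := (hS N (Or.inl hN)).1
    -- Removing `N` from `(x)` leaves an ideal inside `I` but not inside `N`.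
    obtain ⟨L, hL, -, hL0, hL1⟩ := hA.exists_invertible_ordAt_eq_zero hxi
      (Set.finite_singleton N)
      (by rintro _ rfl; exact ⟨hNm, hSi _ (Or.inl hN)⟩)
    have hpow : ∀ N' : Ideal A, N'.IsMaximal → N' ≠ N → ∀ k, x ∈ N' ^ k → L ≤ N' ^ k := by
      intro N' hN' hne k hk
      rw [← hA.le_ordAt_iff hL.ne_bot, hL1 N' hne hN', hA.le_ordAt_iff hxi.ne_bot]
      simpa using hk
    refine (hA.ordAt_eq_zero_iff hL.ne_bot).1 (hL0 N rfl) (le_trans (le_inf ?_ ?_) hIN)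
    · simpa using hpow M hM (hSM N (Or.inl hN)).symm 1 (by simpa using hxM)
    · exact le_iInf₂ fun N' hN' => hpow N' (hS N' (Or.inr hN')).1
        (fun h => Set.disjoint_left.1 hdisj hN (h ▸ hN')) 2 (hS N' (Or.inr hN')).2
  have hI0 : I ≠ ⊥ := fun h0 => hx0 (by simpa [h0] using hxI)
  obtain ⟨J, Q, hJ, -, hQ, hIJ⟩ := hISP I hI0 fun h => hM.ne_top (top_le_iff.1 (h ▸ hIM))
  have hIleJ : I ≤ J := hIJ.le.trans Ideal.mul_le_left
  by_cases hJM : J ≤ M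
  · obtain ⟨L, hL⟩ := hJ.exists_eq_mul_of_le
      ((Ideal.span_singleton_le_iff_mem _).2 (hIleJ hxI))
    have hxJL : x ∈ J * L := hL ▸ Ideal.mem_span_singleton_self x
    have hLM : ¬ L ≤ M := fun h => hx2 (by
      rw [sq]
      exact Ideal.mul_mono hJM h hxJL)
    -- For `N ∈ t`, `J` is not in `N` since `I` is not, so `J * L ≤ N` forces `L ≤ N`.
    refine ht ((hsmall L (Ideal.mul_le_right hxJL) hLM).subset fun N hN => ?_)
    have hNm := (hS N (Or.inl hN)).1
    refine ⟨hNm, (hNm.isPrime.mul_le.1 ?_).resolve_left fun h => hIt N hN (hIleJ.trans h)⟩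
    rw [← hL, Ideal.span_singleton_le_iff_mem]
    exact hSN N (Or.inl hN)
  · obtain ⟨R, hRQ, hRM⟩ := (hM.isPrime.multiset_prod_le).1
      ((hM.isPrime.mul_le.1 (hIJ ▸ hIM)).resolve_left hJM)
    obtain ⟨Q', rfl⟩ := Multiset.exists_cons_of_mem hRQ
    have hIP : I = J * Q'.prod * R := by rw [hIJ, Multiset.prod_cons]; ring
    have hPM : ¬ J * Q'.prod ≤ M := fun h => hx2 (by
      rw [sq]
      exact Ideal.mul_mono h hRM (hIP ▸ hxI))
    have hR0 : R ≠ ⊥ := fun h0 => hI0 (by rw [hIP, h0, Ideal.mul_bot])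
    refine hu ((hsmall _ (Ideal.mul_le_left (hIP ▸ hxI)) hPM).subset fun N hN => ?_)
    have hNm := (hS N (Or.inr hN)).1
    refine ⟨hNm, ?_⟩
    -- If the cofactor of `R` avoids `N`, then `R` alone lies in `N ^ 2`, impossible for a radical
    -- ideal.
    by_contra hPN
    have h2 := (hA.le_ordAt_iff hR0 2).2
      (Ideal.le_pow_of_mul_le_pow hPN (hIP ▸ hIu N hN))
    have := hA.ordAt_le_one_of_isRadical (N := N) hR0 (hQ R hRQ).1
    omega

theorem exists_mem_notMem_sq {M : Ideal A} [hM : M.IsMaximal] {B : Set (Ideal A)}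
    (hB : B.Finite) (hmax : ∀ N ∈ B, N.IsMaximal) :
    ∃ x ∈ M, x ∉ M ^ 2 ∧ ∀ N ∈ B, N ≠ M → x ∉ N := by
  classical
  by_contra! hcon
  let s : Finset (Ideal A) := insert (M ^ 2) (hB.toFinset.erase M)
  have hsub : (M : Set A) ⊆ ⋃ N ∈ (↑s : Set (Ideal A)), (id N : Ideal A) := by
    intro x hx
    by_cases hx2 : x ∈ M ^ 2
    · exact Set.mem_biUnion (by simp [s]) hx2
    · obtain ⟨N, hNB, hNM, hxN⟩ := hcon x hx hx2
      exact Set.mem_biUnion (x := N) (by simp [s, hNB, hNM]) hxN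
  -- Prime avoidance tolerates two nonprime ideals; `M ^ 2` fills both places.
  rw [Ideal.subset_union_prime (M ^ 2) (M ^ 2) fun N hN h _ => by
    simp only [s, Finset.mem_insert, Finset.mem_erase, Set.Finite.mem_toFinset] at hN
    exact (hmax N (hN.resolve_left h).2).isPrime] at hsub
  obtain ⟨N, hN, hMN⟩ := hsub
  simp only [s, Finset.mem_insert, Finset.mem_erase, Set.Finite.mem_toFinset] at hN
  obtain rfl | ⟨hNM, hNB⟩ := hN
  · have := (hA.le_ordAt_iff (hA.maximal_ne_bot hM) 2).2 hMN
    rw [hA.ordAt_self] at this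
    omega
  · exact hNM (hM.eq_of_le (hmax N hNB).ne_top hMN).symm

theorem exists_fg_isRadical_le (hISP : IsISPDomain A)
    (hfin : {M : Ideal A | M.IsMaximal ∧ ¬ IsInvertibleIdeal M}.Finite) (M : Ideal A)
    (hM : M.IsMaximal) : ∃ R ≤ M, R ≠ ⊥ ∧ R.FG ∧ R.IsRadical := by
  by_cases hMi : IsInvertibleIdeal M
  · exact ⟨M, le_rfl, hMi.ne_bot, hMi.fg, hM.isPrime.isRadical⟩
  obtain ⟨x, hxM, hx2, hxB⟩ := hA.exists_mem_notMem_sq (M := M) hfin fun N hN => hN.1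
  have hx : ∀ N : Ideal A, N.IsMaximal → N ≠ M → x ∈ N → IsInvertibleIdeal N :=
    fun N hN hne hxN => by_contra fun h => hxB N ⟨hN, h⟩ hne hxN
  have hxi := IsInvertibleIdeal.span_singleton (x := x) fun h0 => hx2 (h0 ▸ zero_mem _)
  obtain ⟨L, hL, -, hL0, hL1⟩ := hA.exists_invertible_ordAt_eq_zero hxi
    (hA.finite_mem_sq_of_isISPDomain hISP hxM hx2 hx) fun N hN => ⟨hN.1,
      hx N hN.1 (fun h => hx2 (h ▸ hN.2)) (Ideal.pow_le_self two_ne_zero hN.2)⟩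
  refine ⟨L, ?_, hL.ne_bot, hL.fg, hA.isRadical_of_ordAt_le_one hL.ne_bot fun N hN => ?_⟩
  · rw [← pow_one M, ← hA.le_ordAt_iff hL.ne_bot, hL1 M (fun h => hx2 h.2) hM,
      hA.le_ordAt_iff hxi.ne_bot]
    simpa using hxM
  · by_cases hN2 : x ∈ N ^ 2
    · rw [hL0 N ⟨hN, hN2⟩]
      exact zero_le_one
    · rw [hL1 N (fun h => hN2 h.2) hN]
      by_contra! h
      exact hN2 (by simpa using (hA.le_ordAt_iff hxi.ne_bot 2).1 h)

end IsAlmostDedekind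

theorem corollary3p4 (A : Type*) [CommRing A] [IsDomain A] (hA : IsAlmostDedekind A)
    (hfin : {M : Ideal A | M.IsMaximal ∧ ¬ IsInvertibleIdeal M}.Finite) :
    IsISPDomain A ↔ IsSPDomain A :=
  ⟨fun h => hA.isSPDomain (hA.exists_fg_isRadical_le h hfin), IsSPDomain.isISPDomain⟩
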